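/- **Theorem (Embedding Theorem).** Let $n$ be a natural number and let $B_n$ be the $n$-string braid group, with Artin's presentation: generators $\sigma_1,\dots,\sigma_{n-1}$ and relations $\sigma_t\sigma_s=\sigma_s\sigma_t$ if $|t-s|>1$, $\sigma_t\sigma_s\sigma_t=\sigma_s\sigma_t\sigma_s$ if $|t-s|=1$. For $n\ge t>s\ge 1$ put $$a_{ts}=(\sigma_{t-1}\sigma_{t-2}\cdots\sigma_{s+1})\,\sigma_s\,(\sigma_{s+1}^{-1}\cdots\sigma_{t-2}^{-1}\sigma_{t-1}^{-1})\in B_n .$$ Let $B_n^+$ be the monoid presented by generators $a_{ts}$ ($n\ge t>s\ge 1$) and the relations $$a_{ts}a_{rq}=a_{rq}a_{ts}\quad\text{if }(t-r)(t-q)(s-r)(s-q)>0,$$ $$a_{ts}a_{sr}=a_{tr}a_{ts}=a_{sr}a_{tr}\quad\text{if } n\ge t>s>r\ge 1 .$$ These relations hold in $B_n$, so there is a natural monoid homomorphism $B_n^+\to B_n$ sending each generator $a_{ts}$ to the braid $a_{ts}$. A positive word is a finite word in the letters $a_{ts}$; two positive words are positively equivalent if one can be transformed into the other by a finite sequence of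 positive words, each obtained from the preceding one by a single direct application (to a subword, in either direction) of one of the displayed defining relations between the $a_{ts}$. Then the natural map $B_n^+\to B_n$ is injective. That is, if two positive words represent the same element of $B_n$, then they are positively equivalent. -/

import Mathlib

namespace BandBraid

/-! ### The braid group -/

/-- Indices `1, …, n - 1` of the Artin generators of the `n`-string braid group. -/
abbrev ArtinIndex (n : ℕ) : Type := {i : ℕ // 1 ≤ i ∧ i < n}

/-- Artin's relators: `σ i σ j = σ j σ i` if `|i - j| > 1`, and
`σ i σ j σ i = σ j σ i σ j` if `|i - j| = 1`. -/
inductive ArtinRel (n : ℕ) : FreeGroup (ArtinIndex n) → Prop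
  | comm (i j : ArtinIndex n) (h : 1 < |(i.1 : ℤ) - (j.1 : ℤ)|) :
      ArtinRel n ((FreeGroup.of i * FreeGroup.of j) * (FreeGroup.of j * FreeGroup.of i)⁻¹)
  | braid (i j : ArtinIndex n) (h : |(i.1 : ℤ) - (j.1 : ℤ)| = 1) :
      ArtinRel n ((FreeGroup.of i * FreeGroup.of j * FreeGroup.of i) *
        (FreeGroup.of j * FreeGroup.of i * FreeGroup.of j)⁻¹)

/-- The `n`-string braid group `B_n`, in Artin's presentation. -/
abbrev BraidGroup (n : ℕ) : Type := PresentedGroup {w : FreeGroup (ArtinIndex n) | ArtinRel n w}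

/-- The Artin generator `σ_i` of `B_n`, for `1 ≤ i < n` (and, by convention, `1` for any other
value of `i`). -/
def sigma (n i : ℕ) : BraidGroup n :=
  if h : 1 ≤ i ∧ i < n then PresentedGroup.of ⟨i, h⟩ else 1

/-- The product `σ_{t-1} σ_{t-2} ⋯ σ_{s+1}` in `B_n`. -/
def sigmaDesc (n t s : ℕ) : BraidGroup n :=
  ((List.Ico (s + 1) t).reverse.map (sigma n)).prod

/-- The braid
`a_{ts} = (σ_{t-1} ⋯ σ_{s+1}) σ_s (σ_{s+1}⁻¹ ⋯ σ_{t-1}⁻¹)`, meant for `1 ≤ s < t ≤ n`. -/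
def bandBraid (n t s : ℕ) : BraidGroup n :=
  sigmaDesc n t s * sigma n s * (sigmaDesc n t s)⁻¹

/-! ### Positive words and positive equivalence -/

/-- The letters `a_{ts}`, `n ≥ t > s ≥ 1`. -/
@[ext] structure BandGen (n : ℕ) where
  t : ℕ
  s : ℕ
  one_le : 1 ≤ s
  lt : s < t
  le : t ≤ n

/-- Positive words in the band generators. -/
abbrev PosWord (n : ℕ) : Type := FreeMonoid (BandGen n)

/-- The one-letter word `a_{ts}`. -/
def letter {n : ℕ} (t s : ℕ) (h₁ : 1 ≤ s) (h₂ : s < t) (h₃ : t ≤ n) : PosWord n :=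
  FreeMonoid.of ⟨t, s, h₁, h₂, h₃⟩

/-- The defining relations between positive words:
`a_{ts} a_{rq} = a_{rq} a_{ts}` if `(t-r)(t-q)(s-r)(s-q) > 0`, and
`a_{ts} a_{sr} = a_{tr} a_{ts} = a_{sr} a_{tr}` if `n ≥ t > s > r ≥ 1`. -/
inductive BandRel (n : ℕ) : PosWord n → PosWord n → Prop
  | comm (a b : BandGen n)
      (h : 0 < ((a.t : ℤ) - b.t) * ((a.t : ℤ) - b.s) * ((a.s : ℤ) - b.t) * ((a.s : ℤ) - b.s)) :
      BandRel n (FreeMonoid.of a * FreeMonoid.of b) (FreeMonoid.of b * FreeMonoid.of a)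
  | left_mid (t s r : ℕ) (hr : 1 ≤ r) (hrs : r < s) (hst : s < t) (ht : t ≤ n) :
      BandRel n
        (letter t s (hr.trans hrs.le) hst ht * letter s r hr hrs (hst.le.trans ht))
        (letter t r hr (hrs.trans hst) ht * letter t s (hr.trans hrs.le) hst ht)
  | mid_right (t s r : ℕ) (hr : 1 ≤ r) (hrs : r < s) (hst : s < t) (ht : t ≤ n) :
      BandRel n
        (letter t r hr (hrs.trans hst) ht * letter t s (hr.trans hrs.le) hst ht)
        (letter s r hr hrs (hst.le.trans ht) * letter t r hr (hrs.trans hst) ht)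
  | left_right (t s r : ℕ) (hr : 1 ≤ r) (hrs : r < s) (hst : s < t) (ht : t ≤ n) :
      BandRel n
        (letter t s (hr.trans hrs.le) hst ht * letter s r hr hrs (hst.le.trans ht))
        (letter s r hr hrs (hst.le.trans ht) * letter t r hr (hrs.trans hst) ht)

/-- `Y` is obtained from `X` by a single direct application of a defining relation, in either
direction, to a subword. -/
def PosStep {n : ℕ} (X Y : PosWord n) : Prop :=
  ∃ U V L R : PosWord n, (BandRel n L R ∨ BandRel n R L) ∧ X = U * L * V ∧ Y = U * R * V

/-- Positive equivalence: `Y` is obtained from `X` by a finite sequence of positive words, each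
obtained from the preceding one by a single direct application of a defining relation. -/
def PosEquiv {n : ℕ} (X Y : PosWord n) : Prop :=
  Relation.ReflTransGen PosStep X Y

/-- The monoid `B_n^+` presented by the band generators and their defining relations. -/
abbrev BandMonoid (n : ℕ) : Type := PresentedMonoid (BandRel n)

/-- The element of `B_n` represented by a positive word: each letter is read as the braid
`a_{ts}`. -/
def wordBraid (n : ℕ) : PosWord n →* BraidGroup n :=
  FreeMonoid.lift fun a => bandBraid n a.t a.s

/-! ### The defining relations hold in the braid group -/

theorem sigma_comm {n i j : ℕ} (hi : 1 ≤ i) (hij : i + 1 < j) (hj : j < n) :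
    Commute (sigma n i) (sigma n j) := by
  have h1 : 1 ≤ i ∧ i < n := ⟨hi, by omega⟩
  have h2 : 1 ≤ j ∧ j < n := ⟨by omega, hj⟩
  have := PresentedGroup.one_of_mem (rels := {w | ArtinRel n w})
    (ArtinRel.comm (n := n) ⟨i, h1⟩ ⟨j, h2⟩ (by
      rw [abs_sub_comm, lt_abs]; left; simp only; omega))
  rw [map_mul, map_inv, mul_inv_eq_one] at this
  simp only [sigma, h1, h2, and_self, dif_pos]
  exact this

theorem sigma_braid {n i : ℕ} (hi : 1 ≤ i) (hj : i + 1 < n) :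
    sigma n i * sigma n (i + 1) * sigma n i =
      sigma n (i + 1) * sigma n i * sigma n (i + 1) := by
  have h1 : 1 ≤ i ∧ i < n := ⟨hi, by omega⟩
  have h2 : 1 ≤ i + 1 ∧ i + 1 < n := ⟨by omega, hj⟩
  have := PresentedGroup.one_of_mem (rels := {w | ArtinRel n w})
    (ArtinRel.braid (n := n) ⟨i, h1⟩ ⟨i + 1, h2⟩ (by simp))
  rw [map_mul, map_inv, mul_inv_eq_one] at this
  simp only [sigma, h1, h2, and_self, dif_pos]
  exact this

theorem bandBraid_self_succ (n s : ℕ) : bandBraid n (s + 1) s = sigma n s := by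
  simp [bandBraid, sigmaDesc]

theorem bandBraid_succ (n : ℕ) {t s : ℕ} (h : s < t) :
    bandBraid n (t + 1) s = sigma n t * bandBraid n t s * (sigma n t)⁻¹ := by
  have : sigmaDesc n (t + 1) s = sigma n t * sigmaDesc n t s := by
    simp [sigmaDesc, List.Ico.succ_top (show s + 1 ≤ t by omega)]
  simp only [bandBraid, this, mul_inv_rev, mul_assoc]

/-- Whatever commutes with `σ_s, …, σ_{t-1}` commutes with `a_{ts}`. -/
theorem commute_bandBraid {n t s : ℕ} (h : s < t) {g : BraidGroup n}
    (hg : ∀ k, s ≤ k → k < t → Commute g (sigma n k)) : Commute g (bandBraid n t s) := by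
  induction t, h using Nat.le_induction with
  | base => rw [bandBraid_self_succ]; exact hg s le_rfl (by omega)
  | succ t ht ih =>
    rw [bandBraid_succ n ht]
    have h1 := hg t (by omega) (by omega)
    exact (h1.mul_right (ih fun k hk hk' => hg k hk (by omega))).mul_right h1.inv_right

theorem sigma_commute_above {n t s k : ℕ} (hs : 1 ≤ s) (h : s < t) (hk : t < k) (hn : k < n) :
    Commute (sigma n k) (bandBraid n t s) :=
  commute_bandBraid h fun _ h1 _ => (sigma_comm (by omega) (by omega) hn).symm

theorem sigma_commute_inside {n t s k : ℕ} (hs : 1 ≤ s) (hsk : s < k) (hk : k + 1 < t)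
    (hn : t ≤ n) : Commute (sigma n k) (bandBraid n t s) := by
  have hk' : k + 2 ≤ t := hk
  induction t, hk' using Nat.le_induction with
  | base =>
    rw [bandBraid_succ n (show s < k + 1 by omega), bandBraid_succ n hsk]
    have hb := sigma_braid (n := n) (i := k) (by omega) (by omega)
    have hc := sigma_commute_above (n := n) hs hsk (show k < k + 1 by omega) (by omega)
    have e : ∀ a b c : BraidGroup n, a * b * a = b * a * b → Commute b c →
        Commute a (b * (a * c * a⁻¹) * b⁻¹) := by
      intro a b c hab hbc
      have h1 : SemiconjBy (b * a) b a := by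
        simp only [SemiconjBy]; rw [← hab]; simp only [mul_assoc]
      have h3 := (h1.mul_left (show SemiconjBy c b b from hbc.symm)).mul_left h1.inv_symm_left
      have e2 : b * a * c * (b * a)⁻¹ = b * (a * c * a⁻¹) * b⁻¹ := by group
      rw [e2] at h3
      exact h3.eq.symm
    exact e _ _ _ hb hc
  | succ t ht ih =>
    rw [bandBraid_succ n (show s < t by omega)]
    have h1 := sigma_comm (n := n) (i := k) (j := t) (by omega) (by omega) (by omega)
    exact (h1.mul_right (ih (by omega) (by omega))).mul_right h1.inv_right

theorem bandBraid_comm_disjoint {n t s r q : ℕ} (hs : 1 ≤ s) (hst : s < t) (htq : t < q)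
    (hqr : q < r) (hr : r ≤ n) : Commute (bandBraid n t s) (bandBraid n r q) :=
  commute_bandBraid hqr fun _ h1 h2 =>
    (sigma_commute_above hs hst (by omega) (by omega)).symm

theorem bandBraid_comm_nested {n t s r q : ℕ} (hs : 1 ≤ s) (hsq : s < q) (hqr : q < r)
    (hrt : r < t) (ht : t ≤ n) : Commute (bandBraid n t s) (bandBraid n r q) :=
  commute_bandBraid hqr fun _ h1 h2 =>
    (sigma_commute_inside hs (by omega) (by omega) ht).symm

theorem bandBraid_comm {n t s r q : ℕ} (hs : 1 ≤ s) (hst : s < t) (ht : t ≤ n) (hq : 1 ≤ q)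
    (hqr : q < r) (hr : r ≤ n)
    (h : 0 < ((t : ℤ) - r) * ((t : ℤ) - q) * ((s : ℤ) - r) * ((s : ℤ) - q)) :
    Commute (bandBraid n t s) (bandBraid n r q) := by
  have hcase : t < q ∨ r < s ∨ (s < q ∧ r < t) ∨ (q < s ∧ t < r) := by
    by_contra hcon
    have hc : (s ≤ q ∧ q ≤ t ∧ t ≤ r) ∨ (q ≤ s ∧ s ≤ r ∧ r ≤ t) := by omega
    zify at hc
    refine absurd h (not_lt.mpr ?_)
    rcases hc with ⟨h1, h2, h3⟩ | ⟨h1, h2, h3⟩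
    · have a1 : 0 ≤ ((r : ℤ) - t) * (t - q) := mul_nonneg (by omega) (by omega)
      have a2 : 0 ≤ ((r : ℤ) - s) * (q - s) := mul_nonneg (by omega) (by omega)
      nlinarith [mul_nonneg a1 a2]
    · have a1 : 0 ≤ ((t : ℤ) - r) * (t - q) := mul_nonneg (by omega) (by omega)
      have a2 : 0 ≤ ((r : ℤ) - s) * (s - q) := mul_nonneg (by omega) (by omega)
      nlinarith [mul_nonneg a1 a2]
  rcases hcase with h | h | ⟨h, h'⟩ | ⟨h, h'⟩
  · exact bandBraid_comm_disjoint hs hst h hqr hr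
  · exact (bandBraid_comm_disjoint hq hqr h hst ht).symm
  · exact bandBraid_comm_nested hs h hqr h' ht
  · exact (bandBraid_comm_nested hq h hst h' hr).symm

theorem sigma_bandBraid_braid {n s r : ℕ} (hr : 1 ≤ r) (hrs : r < s) (hs : s < n) :
    sigma n s * bandBraid n s r * sigma n s =
      bandBraid n s r * sigma n s * bandBraid n s r := by
  induction s, hrs using Nat.le_induction with
  | base => rw [bandBraid_self_succ]; exact (sigma_braid hr hs).symm
  | succ s hrs ih =>
    have h1 := ih (by omega)
    have h2 := sigma_commute_above (n := n) hr hrs (show s < s + 1 by omega) hs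
    have h3 := sigma_braid (n := n) (i := s) (by omega) hs
    rw [bandBraid_succ n hrs]
    have e : ∀ a b c : BraidGroup n, a * c * a = c * a * c → Commute b c →
        a * b * a = b * a * b →
        b * (a * c * a⁻¹) * b = (a * c * a⁻¹) * b * (a * c * a⁻¹) := by
      intro a b c h1 h2 h3
      have e1 : a * c * a⁻¹ = c⁻¹ * a * c := by
        rw [mul_inv_eq_iff_eq_mul, mul_assoc, mul_assoc, eq_inv_mul_iff_mul_eq, ← mul_assoc,
          ← mul_assoc, ← h1]
      have e2 : b = c⁻¹ * b * c := by rw [mul_assoc, h2.eq, inv_mul_cancel_left]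
      rw [e1]
      calc b * (c⁻¹ * a * c) * b
          = (c⁻¹ * b * c) * (c⁻¹ * a * c) * (c⁻¹ * b * c) := by rw [← e2]
        _ = c⁻¹ * (b * a * b) * c := by group
        _ = c⁻¹ * (a * b * a) * c := by rw [h3]
        _ = (c⁻¹ * a * c) * (c⁻¹ * b * c) * (c⁻¹ * a * c) := by group
        _ = (c⁻¹ * a * c) * b * (c⁻¹ * a * c) := by rw [← e2]
    exact e _ _ _ h1 h2 h3

theorem bandBraid_triangle {n t s r : ℕ} (hr : 1 ≤ r) (hrs : r < s) (hst : s < t) (ht : t ≤ n) :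
    bandBraid n t s * bandBraid n s r = bandBraid n t r * bandBraid n t s ∧
      bandBraid n t s * bandBraid n s r = bandBraid n s r * bandBraid n t r := by
  induction t, hst using Nat.le_induction with
  | base =>
    have h := sigma_bandBraid_braid hr hrs (show s < n by omega)
    rw [bandBraid_self_succ, bandBraid_succ n hrs]
    refine ⟨by group, ?_⟩
    rw [← mul_assoc, eq_mul_inv_iff_mul_eq, h, mul_assoc]
  | succ t hst ih =>
    obtain ⟨h1, h2⟩ := ih (by omega)
    have hc := sigma_commute_above (n := n) hr hrs (show s < t by omega) (by omega)
    rw [bandBraid_succ n (show s < t by omega), bandBraid_succ n (show r < t by omega)]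
    have e : ∀ g a b c : BraidGroup n, Commute g b → a * b = c * a → a * b = b * c →
        g * a * g⁻¹ * b = g * c * g⁻¹ * (g * a * g⁻¹) ∧
          g * a * g⁻¹ * b = b * (g * c * g⁻¹) := by
      intro g a b c hc h1 h2
      have e0 : b = g * b * g⁻¹ := by rw [hc.eq, mul_inv_cancel_right]
      have e1 : g * a * g⁻¹ * b = g * (a * b) * g⁻¹ := by
        calc g * a * g⁻¹ * b = g * a * g⁻¹ * (g * b * g⁻¹) := by rw [← e0]
          _ = g * (a * b) * g⁻¹ := by group
      have e2 : b * (g * c * g⁻¹) = g * (b * c) * g⁻¹ := by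
        calc b * (g * c * g⁻¹) = (g * b * g⁻¹) * (g * c * g⁻¹) := by rw [← e0]
          _ = g * (b * c) * g⁻¹ := by group
      rw [e2, e1]
      exact ⟨by rw [h1]; group, by rw [h2]⟩
    exact e _ _ _ _ hc h1 h2

theorem wordBraid_rel {n : ℕ} {X Y : PosWord n} (h : BandRel n X Y) :
    wordBraid n X = wordBraid n Y := by
  cases h with
  | comm a b h =>
    simpa [wordBraid] using (bandBraid_comm a.one_le a.lt a.le b.one_le b.lt b.le h).eq
  | left_mid t s r hr hrs hst ht =>
    simpa [wordBraid, letter] using (bandBraid_triangle hr hrs hst ht).1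
  | mid_right t s r hr hrs hst ht =>
    have := bandBraid_triangle hr hrs hst ht
    simpa [wordBraid, letter] using this.1.symm.trans this.2
  | left_right t s r hr hrs hst ht =>
    simpa [wordBraid, letter] using (bandBraid_triangle hr hrs hst ht).2

/-- The natural map `B_n^+ → B_n`: the monoid homomorphism that sends each generator `a_{ts}` to
the braid `a_{ts}`. -/
def naturalMap (n : ℕ) : BandMonoid n →* BraidGroup n :=
  PresentedMonoid.lift (fun a : BandGen n => bandBraid n a.t a.s) fun _ _ h => wordBraid_rel h

end BandBraid

namespace BandBraid

/-! ### Noncrossing partitions -/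

/-- Noncrossing partitions of `{1, …, n}`, as equivalence relations on `ℕ` that are trivial outside
of `{1, …, n}`. -/
@[ext] structure NCPart (n : ℕ) where
  rel : ℕ → ℕ → Prop
  refl : ∀ i, rel i i
  symm : ∀ {i j}, rel i j → rel j i
  trans : ∀ {i j k}, rel i j → rel j k → rel i k
  supp : ∀ {i j}, rel i j → i ≠ j → 1 ≤ i ∧ i ≤ n
  noncrossing : ∀ {i j k l}, i < j → j < k → k < l → rel i k → rel j l → rel i j

namespace BandGen

variable {n : ℕ}

/-- `i` and `j` lie on the same side of the cut of `{1, …, n}` into the interval `(s, t]` and its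
complement. -/
def Same (a : BandGen n) (i j : ℕ) : Prop := (a.s < i ∧ i ≤ a.t) ↔ (a.s < j ∧ j ≤ a.t)

theorem not_same (a : BandGen n) : ¬ a.Same a.t a.s := by
  have := a.lt; unfold Same; omega

end BandGen

namespace NCPart

variable {n : ℕ}

/-- The atom `a` lies below the partition `r`. -/
def Has (r : NCPart n) (a : BandGen n) : Prop := r.rel a.t a.s

/-- The discrete partition. -/
def bot (n : ℕ) : NCPart n where
  rel i j := i = j
  refl _ := rfl
  symm h := h.symm
  trans h h' := h.trans h'
  supp h h' := absurd h h'
  noncrossing := by intros; omega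

/-- The partition of `{1, …, n}` with a single block. -/
def top (n : ℕ) : NCPart n where
  rel i j := i = j ∨ ((1 ≤ i ∧ i ≤ n) ∧ (1 ≤ j ∧ j ≤ n))
  refl _ := .inl rfl
  symm := by omega
  trans := by omega
  supp := by omega
  noncrossing := by omega

/-- Refine a partition by the cut into `(s, t]` and its complement. -/
def cut (a : BandGen n) (r : NCPart n) : NCPart n where
  rel i j := r.rel i j ∧ a.Same i j
  refl i := ⟨r.refl i, Iff.rfl⟩
  symm h := ⟨r.symm h.1, Iff.symm h.2⟩
  trans h h' := ⟨r.trans h.1 h'.1, Iff.trans h.2 h'.2⟩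
  supp h := r.supp h.1
  noncrossing := by
    rintro i j k l h1 h2 h3 ⟨h4, h5⟩ ⟨h6, h7⟩
    refine ⟨r.noncrossing h1 h2 h3 h4 h6, ?_⟩
    unfold BandGen.Same at *
    omega

theorem rel_of_cross (v : NCPart n) {i k p q : ℕ} (hik : v.rel i k) (hip : i < p) (hpk : p < k)
    (hpq : v.rel p q) (hq : q ≤ i ∨ k ≤ q) : v.rel i p := by
  rcases hq with hq | hq
  · rcases hq.eq_or_lt with rfl | hq
    · exact v.symm hpq
    · exact v.trans (v.symm (v.noncrossing hq hip hpk (v.symm hpq) hik)) (v.symm hpq)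
  · rcases hq.eq_or_lt with rfl | hq
    · exact v.trans hik (v.symm hpq)
    · exact v.noncrossing hip hpk hq hik hpq

/-- `i` is in the block of an endpoint of `a`. -/
def Touch (a : BandGen n) (v : NCPart n) (i : ℕ) : Prop := v.rel i a.s ∨ v.rel i a.t

theorem Touch.of_rel {a : BandGen n} {v : NCPart n} {i j : ℕ} (h : v.Touch a i)
    (hij : v.rel j i) : v.Touch a j :=
  h.imp (v.trans hij) (v.trans hij)

theorem rel_or_touch_of_cross {a : BandGen n} {v : NCPart n}
    (hv : ∀ i j, v.rel i j → a.Same i j) {i k p q : ℕ} (hik : v.rel i k) (hip : i < p)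
    (hpk : p < k) (hq : q < i ∨ k < q) (hp : v.Touch a p) (hq' : v.Touch a q) :
    v.rel i p ∨ v.Touch a i := by
  have hst := a.lt
  have hs := hv _ _ hik
  unfold BandGen.Same at hs
  have hqq : q ≤ i ∨ k ≤ q := by omega
  rcases hp with hp | hp <;> rcases hq' with hq' | hq'
  · exact .inl (v.rel_of_cross hik hip hpk (v.trans hp (v.symm hq')) hqq)
  · by_cases h1 : a.s ≤ i ∨ k ≤ a.s
    · exact .inl (v.rel_of_cross hik hip hpk hp h1)
    by_cases h2 : a.t < k
    · exact .inr (.inr (v.rel_of_cross hik (by omega) h2 (v.symm hq') hqq))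
    obtain rfl : k = a.t := by omega
    exact .inr (.inr hik)
  · by_cases h1 : a.t ≤ i ∨ k ≤ a.t
    · exact .inl (v.rel_of_cross hik hip hpk hp h1)
    by_cases h2 : i < a.s
    · exact .inr (.inl (v.rel_of_cross hik h2 (by omega) (v.symm hq') hqq))
    obtain rfl : i = a.s := by omega
    exact .inr (.inl (v.refl _))
  · exact .inl (v.rel_of_cross hik hip hpk (v.trans hp (v.symm hq')) hqq)

/-- Cut along `a`, then merge the blocks of the two endpoints of `a`. -/
def act (a : BandGen n) (u : NCPart n) : NCPart n where
  rel i j := (cut a u).rel i j ∨ ((cut a u).Touch a i ∧ (cut a u).Touch a j)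
  refl i := .inl (refl _ i)
  symm h := h.imp (symm _) And.symm
  trans := by
    rintro i j k (h | ⟨h1, h2⟩) (h' | ⟨h3, h4⟩)
    · exact .inl (trans _ h h')
    · exact .inr ⟨h3.of_rel h, h4⟩
    · exact .inr ⟨h1, h2.of_rel (symm _ h')⟩
    · exact .inr ⟨h1, h4⟩
  supp := by
    rintro i j (h | ⟨h1, h2⟩) hij
    · exact supp _ h hij
    · have := a.one_le
      have := a.lt
      have := a.le
      rcases h1 with h1 | h1
      · by_cases h : i = a.s
        · omega
        · exact supp _ h1 h
      · by_cases h : i = a.t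
        · omega
        · exact supp _ h1 h
  noncrossing := by
    have hv : ∀ i j, (cut a u).rel i j → a.Same i j := fun _ _ h => h.2
    rintro i j k l h1 h2 h3 (h | ⟨h4, h5⟩) (h' | ⟨h6, h7⟩)
    · exact .inl (noncrossing _ h1 h2 h3 h h')
    · exact (rel_or_touch_of_cross hv h h1 h2 (.inr h3) h6 h7).imp_right fun h => ⟨h, h6⟩
    · refine .inr ⟨h4, ?_⟩
      rcases rel_or_touch_of_cross hv h' h2 h3 (.inl h1) h5 h4 with h | h
      · exact h5.of_rel h
      · exact h
    · exact .inr ⟨h4, h6⟩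

theorem has_act (a : BandGen n) (u : NCPart n) : (act a u).Has a :=
  .inr ⟨.inr (refl _ _), .inl (refl _ _)⟩

theorem cut_comm (a b : BandGen n) (u : NCPart n) : cut a (cut b u) = cut b (cut a u) := by
  ext i j; simp only [cut]; tauto

theorem cut_cut (a : BandGen n) (u : NCPart n) : cut a (cut a u) = cut a u := by
  ext i j; simp only [cut]; tauto

theorem cut_act (a : BandGen n) (u : NCPart n) : cut a (act a u) = cut a u := by
  ext i j
  refine ⟨?_, fun h => ⟨.inl h, h.2⟩⟩
  rintro ⟨h | ⟨h1, h2⟩, h⟩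
  · exact h
  have hst := a.not_same
  rcases h1 with h1 | h1 <;> rcases h2 with h2 | h2
  · exact trans _ h1 (symm _ h2)
  · exact absurd ((h2.2.symm.trans h.symm).trans h1.2) hst
  · exact absurd ((h1.2.symm.trans h).trans h2.2) hst
  · exact trans _ h1 (symm _ h2)

theorem act_eq_self {a : BandGen n} {r : NCPart n} (h : r.Has a) : act a r = r := by
  have hst := a.lt
  have key : ∀ {i}, (cut a r).Touch a i → r.rel i a.s := by
    rintro i (h1 | h1)
    · exact h1.1
    · exact r.trans h1.1 h
  ext i j
  constructor
  · rintro (h1 | ⟨h1, h2⟩)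
    · exact h1.1
    · exact r.trans (key h1) (r.symm (key h2))
  · intro hij
    by_cases hs : a.Same i j
    · exact .inl ⟨hij, hs⟩
    refine .inr ?_
    have main : ∀ {i j}, r.rel i j → (a.s < i ∧ i ≤ a.t) → ¬ (a.s < j ∧ j ≤ a.t) →
        r.rel i a.s := by
      intro i j hij hi hj
      rcases lt_or_eq_of_le hi.2 with hit | rfl
      · exact r.symm (r.rel_of_cross (r.symm h) hi.1 hit hij (by omega))
      · exact h
    have tch : ∀ {i}, r.rel i a.s → (cut a r).Touch a i := by
      intro i hi
      by_cases hi' : a.Same i a.s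
      · exact .inl ⟨hi, hi'⟩
      · refine .inr ⟨r.trans hi (r.symm h), ?_⟩
        have := a.not_same
        unfold BandGen.Same at *
        tauto
    have : r.rel i a.s := by
      by_cases hi : a.s < i ∧ i ≤ a.t
      · exact main hij hi fun hj => hs (iff_of_true hi hj)
      · have hj : a.s < j ∧ j ≤ a.t := by unfold BandGen.Same at hs; tauto
        exact r.trans hij (main (r.symm hij) hj hi)
    exact ⟨tch this, tch (r.trans (r.symm hij) this)⟩

theorem act_cut (a : BandGen n) (u : NCPart n) : act a (cut a u) = act a u := by
  ext i j
  simp only [act, cut_cut]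

theorem eq_of_cut_eq {a : BandGen n} {x y : NCPart n} (hx : x.Has a) (hy : y.Has a)
    (h : cut a x = cut a y) : x = y := by
  rw [← act_eq_self hx, ← act_eq_self hy, ← act_cut, h, act_cut]

end NCPart

/-- The combinatorial content of a relation `a b = c d`. -/
structure Exchange {n : ℕ} (a b c d : BandGen n) : Prop where
  same_left : a.Same b.t b.s
  same_right : c.Same d.t d.s
  same_iff : ∀ i j, (a.Same i j ∧ b.Same i j) ↔ (c.Same i j ∧ d.Same i j)
  has : ∀ r : NCPart n, r.Has a → r.Has b → r.Has c ∧ r.Has d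

namespace Exchange

variable {n : ℕ} {a b c d : BandGen n}

open NCPart

theorem cut_cut (h : Exchange a b c d) (r : NCPart n) :
    cut b (cut a r) = cut d (cut c r) := by
  ext i j
  have := h.same_iff i j
  simp only [cut]; tauto

theorem act_act (h : Exchange a b c d) (u : NCPart n) :
    act a (act b u) = act c (act d u) := by
  have hxb : (act a (act b u)).Has b := by
    have : (cut a (act b u)).Has b := ⟨has_act b u, h.same_left⟩
    rw [← cut_act] at this
    exact this.1
  have hyd : (act c (act d u)).Has d := by
    have : (cut c (act d u)).Has d := ⟨has_act d u, h.same_right⟩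
    rw [← cut_act] at this
    exact this.1
  obtain ⟨hxc, hxd⟩ := h.has _ (has_act _ _) hxb
  refine eq_of_cut_eq hxc (has_act _ _) (eq_of_cut_eq (a := d) ⟨hxd, h.same_right⟩
    ⟨hyd, h.same_right⟩ ?_)
  rw [← h.cut_cut, cut_act, cut_comm, cut_act, cut_comm, h.cut_cut, cut_act, cut_comm d c (act d u),
    cut_act, cut_comm]

end Exchange

theorem BandGen.comm_cases {n : ℕ} (a b : BandGen n)
    (h : 0 < ((a.t : ℤ) - b.t) * ((a.t : ℤ) - b.s) * ((a.s : ℤ) - b.t) * ((a.s : ℤ) - b.s)) :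
    a.t < b.s ∨ b.t < a.s ∨ (a.s < b.s ∧ b.t < a.t) ∨ (b.s < a.s ∧ a.t < b.t) := by
  have ha := a.lt
  have hb := b.lt
  by_contra hcon
  have hc : (a.s ≤ b.s ∧ b.s ≤ a.t ∧ a.t ≤ b.t) ∨ (b.s ≤ a.s ∧ a.s ≤ b.t ∧ b.t ≤ a.t) := by omega
  zify at hc ha hb
  refine absurd h (not_lt.mpr ?_)
  rcases hc with ⟨h1, h2, h3⟩ | ⟨h1, h2, h3⟩
  · have a1 : 0 ≤ ((b.t : ℤ) - a.t) * (a.t - b.s) := mul_nonneg (by omega) (by omega)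
    have a2 : 0 ≤ ((b.t : ℤ) - a.s) * (b.s - a.s) := mul_nonneg (by omega) (by omega)
    linarith [mul_nonneg a1 a2]
  · have a1 : 0 ≤ ((a.t : ℤ) - b.t) * (a.t - b.s) := mul_nonneg (by omega) (by omega)
    have a2 : 0 ≤ ((b.t : ℤ) - a.s) * (a.s - b.s) := mul_nonneg (by omega) (by omega)
    linarith [mul_nonneg a1 a2]

theorem exchange_comm {n : ℕ} (a b : BandGen n)
    (h : a.t < b.s ∨ b.t < a.s ∨ (a.s < b.s ∧ b.t < a.t) ∨ (b.s < a.s ∧ a.t < b.t)) :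
    Exchange a b b a := by
  have ha := a.lt
  have hb := b.lt
  refine ⟨?_, ?_, fun i j => and_comm, fun r h h' => ⟨h', h⟩⟩ <;> unfold BandGen.Same <;> omega

theorem exchange_left_mid {n t s r : ℕ} (hr : 1 ≤ r) (hrs : r < s) (hst : s < t) (ht : t ≤ n) :
    Exchange (n := n) ⟨t, s, hr.trans hrs.le, hst, ht⟩ ⟨s, r, hr, hrs, hst.le.trans ht⟩
      ⟨t, r, hr, hrs.trans hst, ht⟩ ⟨t, s, hr.trans hrs.le, hst, ht⟩ := by
  refine ⟨?_, ?_, fun i j => ?_, fun p h h' => ⟨p.trans h h', h⟩⟩ <;>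
    simp only [BandGen.Same] <;> omega

theorem exchange_mid_right {n t s r : ℕ} (hr : 1 ≤ r) (hrs : r < s) (hst : s < t) (ht : t ≤ n) :
    Exchange (n := n) ⟨t, r, hr, hrs.trans hst, ht⟩ ⟨t, s, hr.trans hrs.le, hst, ht⟩
      ⟨s, r, hr, hrs, hst.le.trans ht⟩ ⟨t, r, hr, hrs.trans hst, ht⟩ := by
  refine ⟨?_, ?_, fun i j => ?_, fun p h h' => ⟨p.trans (p.symm h') h, h⟩⟩ <;>
    simp only [BandGen.Same] <;> omega

theorem exchange_left_right {n t s r : ℕ} (hr : 1 ≤ r) (hrs : r < s) (hst : s < t) (ht : t ≤ n) :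
    Exchange (n := n) ⟨t, s, hr.trans hrs.le, hst, ht⟩ ⟨s, r, hr, hrs, hst.le.trans ht⟩
      ⟨s, r, hr, hrs, hst.le.trans ht⟩ ⟨t, r, hr, hrs.trans hst, ht⟩ := by
  refine ⟨?_, ?_, fun i j => ?_, fun p h h' => ⟨h', p.trans h h'⟩⟩ <;>
    simp only [BandGen.Same] <;> omega

theorem BandRel.exists_exchange {n : ℕ} {L R : PosWord n} (h : BandRel n L R) :
    ∃ a b c d : BandGen n, L = FreeMonoid.of a * FreeMonoid.of b ∧
      R = FreeMonoid.of c * FreeMonoid.of d ∧ Exchange a b c d := by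
  cases h with
  | comm a b h => exact ⟨a, b, b, a, rfl, rfl, exchange_comm a b (a.comm_cases b h)⟩
  | left_mid t s r hr hrs hst ht =>
    exact ⟨_, _, _, _, rfl, rfl, exchange_left_mid hr hrs hst ht⟩
  | mid_right t s r hr hrs hst ht =>
    exact ⟨_, _, _, _, rfl, rfl, exchange_mid_right hr hrs hst ht⟩
  | left_right t s r hr hrs hst ht =>
    exact ⟨_, _, _, _, rfl, rfl, exchange_left_right hr hrs hst ht⟩

/-! ### Simple elements -/

variable {n : ℕ}

/-- The generator `a_{ts}` of the monoid. -/
abbrev gen (a : BandGen n) : BandMonoid n := PresentedMonoid.of (BandRel n) a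

theorem gen_mul_gen {a b c d : BandGen n}
    (h : BandRel n (FreeMonoid.of a * FreeMonoid.of b) (FreeMonoid.of c * FreeMonoid.of d)) :
    gen a * gen b = gen c * gen d :=
  PresentedMonoid.mk_eq_mk_of_rel h

theorem gen_comm {a b : BandGen n}
    (h : a.t < b.s ∨ b.t < a.s ∨ (a.s < b.s ∧ b.t < a.t) ∨ (b.s < a.s ∧ a.t < b.t)) :
    gen a * gen b = gen b * gen a := by
  refine gen_mul_gen (.comm a b ?_)
  have ha := a.lt
  have hb := b.lt
  rcases h with h | h | ⟨h, h'⟩ | ⟨h, h'⟩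
  · exact mul_pos_of_neg_of_neg (mul_neg_of_pos_of_neg
      (mul_pos_of_neg_of_neg (by omega) (by omega)) (by omega)) (by omega)
  · exact mul_pos (mul_pos (mul_pos (by omega) (by omega)) (by omega)) (by omega)
  · exact mul_pos_of_neg_of_neg (mul_neg_of_pos_of_neg
      (mul_pos (by omega) (by omega)) (by omega)) (by omega)
  · exact mul_pos (mul_pos_of_neg_of_neg
      (mul_neg_of_neg_of_pos (by omega) (by omega)) (by omega)) (by omega)

/-- The action of the monoid on noncrossing partitions, by computation of the maximal simple left
divisor. -/
def head (n : ℕ) : BandMonoid n →* Function.End (NCPart n) :=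
  PresentedMonoid.lift (M := Function.End (NCPart n)) (fun a => NCPart.act a) (by
    intro L R hLR
    obtain ⟨a, b, c, d, rfl, rfl, h⟩ := hLR.exists_exchange
    simp only [map_mul]
    exact funext h.act_act)

theorem head_gen_mul (a : BandGen n) (x : BandMonoid n) (u : NCPart n) :
    head n (gen a * x) u = NCPart.act a (head n x u) := by
  rw [map_mul]; rfl

namespace NCPart

theorem exists_has {r : NCPart n} (h : r ≠ bot n) : ∃ a, r.Has a := by
  by_contra hcon
  push Not at hcon
  have key : ∀ {i j}, r.rel i j → ¬ i < j := fun {i j} hij hlt =>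
    hcon ⟨j, i, (r.supp hij hlt.ne).1, hlt, (r.supp (r.symm hij) hlt.ne').2⟩ (r.symm hij)
  refine h ?_
  ext i j
  refine ⟨fun hij => ?_, fun hij => hij ▸ r.refl i⟩
  have h1 := key hij
  have h2 := key (r.symm hij)
  exact le_antisymm (not_lt.1 h2) (not_lt.1 h1)

theorem not_has_bot (a : BandGen n) : ¬ (bot n).Has a := fun h => a.lt.ne' h

open Classical in
/-- The number of pairs of related elements. -/
noncomputable def rank (r : NCPart n) : ℕ :=
  ((Finset.range (n + 1) ×ˢ Finset.range (n + 1)).filter fun p => r.rel p.1 p.2).card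

theorem rank_cut_lt {a : BandGen n} {r : NCPart n} (h : r.Has a) : (cut a r).rank < r.rank := by
  classical
  unfold rank
  refine Finset.card_lt_card (Finset.ssubset_iff_of_subset ?_ |>.2 ⟨(a.t, a.s), ?_, ?_⟩)
  · exact Finset.monotone_filter_right _ fun p _ hp => hp.1
  · have := a.lt
    have := a.le
    exact Finset.mem_filter.2 ⟨by simp only [Finset.mem_product, Finset.mem_range]; omega, h⟩
  · simp only [Finset.mem_filter, not_and]
    exact fun _ h => a.not_same h.2

/-- `m` is the product of atoms along a chain of cuts from `r` to the discrete partition. -/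
inductive IsSimple : NCPart n → BandMonoid n → Prop
  | bot : IsSimple (bot n) 1
  | mul (a : BandGen n) (r : NCPart n) (m : BandMonoid n) (h : r.Has a)
      (hm : IsSimple (cut a r) m) : IsSimple r (gen a * m)

theorem exists_isSimple (r : NCPart n) : ∃ m, IsSimple r m := by
  induction hk : r.rank using Nat.strong_induction_on generalizing r with
  | _ k ih =>
    by_cases h : r = bot n
    · exact ⟨1, h ▸ .bot⟩
    · obtain ⟨a, ha⟩ := exists_has h
      obtain ⟨m, hm⟩ := ih _ (hk ▸ rank_cut_lt ha) _ rfl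
      exact ⟨_, .mul a r m ha hm⟩

/-- The atoms `a` and `b` below `r` have a common multiple `a c = b d` of length two. -/
def Adj (r : NCPart n) (a b : BandGen n) : Prop :=
  ∃ c d : BandGen n, gen a * gen c = gen b * gen d ∧ (cut a r).Has c ∧ (cut b r).Has d ∧
    cut c (cut a r) = cut d (cut b r)

theorem Adj.symm {r : NCPart n} {a b : BandGen n} : r.Adj a b → r.Adj b a
  | ⟨c, d, h1, h2, h3, h4⟩ => ⟨d, c, h1.symm, h3, h2, h4.symm⟩

theorem adj_of_exchange {r : NCPart n} {a b c d : BandGen n} (h : Exchange a b c d)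
    (he : gen a * gen b = gen c * gen d) (ha : r.Has a) (hb : r.Has b) : r.Adj a c :=
  ⟨b, d, he, ⟨hb, h.same_left⟩, ⟨(h.has r ha hb).2, h.same_right⟩, h.cut_cut r⟩

/-- Any two atoms below a noncrossing partition are joined by a path of adjacent atoms. -/
theorem eq_or_adj {r : NCPart n} {a b : BandGen n} (ha : r.Has a) (hb : r.Has b) :
    a = b ∨ r.Adj a b ∨ ∃ e, r.Has e ∧ r.Adj a e ∧ r.Adj e b := by
  have key : ∀ {a b : BandGen n}, r.Has a → r.Has b → a.s ≤ b.s →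
      a = b ∨ r.Adj a b ∨ ∃ e, r.Has e ∧ r.Adj a e ∧ r.Adj e b := by
    rintro ⟨t, s, hs, hst, ht⟩ ⟨q, p, hp, hpq, hq⟩ ha hb hle
    simp only at hle
    simp only [Has] at ha hb
    by_cases hc : t < p ∨ (s < p ∧ q < t)
    · have hc' : t < p ∨ q < s ∨ (s < p ∧ q < t) ∨ (p < s ∧ t < q) := by omega
      exact .inr (.inl (adj_of_exchange (exchange_comm _ _ hc') (gen_comm hc') ha hb))
    rcases hle.eq_or_lt with rfl | hsp
    · rcases lt_trichotomy t q with h | rfl | h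
      · exact .inr (.inl (adj_of_exchange (exchange_mid_right hs hst h hq)
          (gen_mul_gen (.mid_right q t s hs hst h hq)) hb (r.trans hb (r.symm ha))).symm)
      · exact .inl rfl
      · exact .inr (.inl (adj_of_exchange (exchange_mid_right hs hpq h ht)
          (gen_mul_gen (.mid_right t q s hs hpq h ht)) ha (r.trans ha (r.symm hb))))
    rcases eq_or_lt_of_le (show p ≤ t by omega) with rfl | hpt
    · exact .inr (.inl (adj_of_exchange (exchange_left_right hs hst hpq hq)
        (gen_mul_gen (.left_right q p s hs hst hpq hq)) hb ha).symm)
    have hps : r.rel p s := by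
      rcases eq_or_lt_of_le (show t ≤ q by omega) with rfl | htq
      · exact r.trans (r.symm hb) ha
      · exact r.symm (r.noncrossing hsp hpt htq (r.symm ha) (r.symm hb))
    have h1 := adj_of_exchange (exchange_left_mid hs hsp hpt ht)
      (gen_mul_gen (.left_mid t p s hs hsp hpt ht)) (r.trans ha (r.symm hps)) hps
    rcases eq_or_lt_of_le (show t ≤ q by omega) with rfl | htq
    · exact .inr (.inl h1.symm)
    · refine .inr (.inr ⟨_, r.trans ha (r.symm hps), h1.symm, ?_⟩)
      exact (adj_of_exchange (exchange_mid_right hp hpt htq hq)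
        (gen_mul_gen (.mid_right q t p hp hpt htq hq)) hb
        (r.trans hb (r.trans hps (r.symm ha)))).symm
  rcases le_total a.s b.s with h | h
  · exact key ha hb h
  · rcases key hb ha h with h | h | ⟨e, h1, h2, h3⟩
    · exact .inl h.symm
    · exact .inr (.inl h.symm)
    · exact .inr (.inr ⟨e, h1, h3.symm, h2.symm⟩)

theorem IsSimple.unique {r : NCPart n} {m m' : BandMonoid n} (hm : IsSimple r m)
    (hm' : IsSimple r m') : m = m' := by
  induction hk : r.rank using Nat.strong_induction_on generalizing r m m' with
  | _ k ih =>
    have adj : ∀ {a b : BandGen n} {x y : BandMonoid n}, r.Has a → r.Has b → r.Adj a b →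
        IsSimple (cut a r) x → IsSimple (cut b r) y → gen a * x = gen b * y := by
      rintro a b x y ha hb ⟨c, d, h1, h2, h3, h4⟩ hx hy
      obtain ⟨z, hz⟩ := exists_isSimple (cut c (cut a r))
      rw [ih _ (hk ▸ rank_cut_lt ha) hx (.mul c _ z h2 hz) rfl,
        ih _ (hk ▸ rank_cut_lt hb) hy (.mul d _ z h3 (h4 ▸ hz)) rfl, ← mul_assoc, h1, mul_assoc]
    cases hm with
    | bot =>
      cases hm' with
      | bot => rfl
      | mul b _ y hb hy => exact absurd hb (not_has_bot b)
    | mul a _ x ha hx =>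
      cases hm' with
      | bot => exact absurd ha (not_has_bot a)
      | mul b _ y hb hy =>
        rcases eq_or_adj ha hb with rfl | h | ⟨e, he, h, h'⟩
        · rw [ih _ (hk ▸ rank_cut_lt ha) hx hy rfl]
        · exact adj ha hb h hx hy
        · obtain ⟨z, hz⟩ := exists_isSimple (cut e r)
          exact (adj ha he h hx hz).trans (adj he hb h' hz hy)

/-- The simple element of the monoid given by a noncrossing partition. -/
noncomputable def simple (r : NCPart n) : BandMonoid n := (exists_isSimple r).choose

theorem isSimple_simple (r : NCPart n) : IsSimple r r.simple := (exists_isSimple r).choose_spec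

theorem simple_eq {r : NCPart n} {a : BandGen n} (h : r.Has a) :
    r.simple = gen a * (cut a r).simple :=
  r.isSimple_simple.unique (.mul a r _ h (isSimple_simple _))

theorem simple_bot : (bot n).simple = 1 := (isSimple_simple _).unique .bot

theorem simple_dvd_simple {v u : NCPart n} (h : ∀ i j, v.rel i j → u.rel i j) :
    v.simple ∣ u.simple := by
  induction hk : v.rank using Nat.strong_induction_on generalizing v u with
  | _ k ih =>
    by_cases hv : v = bot n
    · rw [hv, simple_bot]; exact one_dvd _
    · obtain ⟨a, ha⟩ := exists_has hv
      rw [simple_eq ha, simple_eq (r := u) (h _ _ ha)]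
      exact mul_dvd_mul_left _ (ih _ (hk ▸ rank_cut_lt ha) (fun i j hij => ⟨h _ _ hij.1, hij.2⟩) rfl)

theorem simple_act (a : BandGen n) (u : NCPart n) :
    (act a u).simple = gen a * (cut a u).simple := by
  rw [simple_eq (has_act a u), cut_act]

end NCPart

open NCPart

theorem simple_head_dvd (x : BandMonoid n) : (head n x (bot n)).simple ∣ x := by
  induction x using PresentedMonoid.inductionOn with | _ w
  induction w using FreeMonoid.inductionOn' with
  | one =>
    rw [map_one, map_one]
    exact simple_bot.dvd
  | of_mul a w ih =>
    rw [map_mul]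
    change (head n (gen a * _) _).simple ∣ gen a * _
    rw [head_gen_mul, simple_act]
    exact mul_dvd_mul_left _ ((simple_dvd_simple (v := cut a _) fun _ _ => And.left).trans ih)

/-! ### Left cancellation -/

/-- The class of a positive word in the monoid. -/
abbrev cls (w : PosWord n) : BandMonoid n := PresentedMonoid.mk (BandRel n) w

theorem of_mul_inj {a b : BandGen n} {X Y : PosWord n}
    (h : FreeMonoid.of a * X = FreeMonoid.of b * Y) : a = b ∧ X = Y :=
  List.cons.inj h

theorem PosStep.symm {X Y : PosWord n} : PosStep X Y → PosStep Y X
  | ⟨U, V, L, R, h, hX, hY⟩ => ⟨U, V, R, L, h.symm, hY, hX⟩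

theorem PosEquiv.mul {X Y Z W : PosWord n} (h : PosEquiv X Y) (h' : PosEquiv Z W) :
    PosEquiv (X * Z) (Y * W) := by
  have h1 : PosEquiv (X * Z) (Y * Z) := by
    refine Relation.ReflTransGen.lift (· * Z) ?_ _ _ h
    rintro _ _ ⟨U, V, L, R, h, rfl, rfl⟩
    exact ⟨U, V * Z, L, R, h, by simp only [mul_assoc], by simp only [mul_assoc]⟩
  have h2 : PosEquiv (Y * Z) (Y * W) := by
    refine Relation.ReflTransGen.lift (Y * ·) ?_ _ _ h'
    rintro _ _ ⟨U, V, L, R, h, rfl, rfl⟩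
    exact ⟨Y * U, V, L, R, h, by simp only [mul_assoc], by simp only [mul_assoc]⟩
  exact h1.trans h2

/-- Positive equivalence as a congruence. -/
def posCon (n : ℕ) : Con (PosWord n) where
  r := PosEquiv
  iseqv := ⟨fun _ => .refl, fun h =>
    Relation.ReflTransGen.mono (fun _ _ => PosStep.symm) _ _ (Relation.ReflTransGen.swap _ _ h),
    fun h h' => h.trans h'⟩
  mul' := PosEquiv.mul

theorem posEquiv_of_cls_eq {X Y : PosWord n} (h : cls X = cls Y) : PosEquiv X Y := by
  have hle : conGen (BandRel n) ≤ posCon n := Con.conGen_le.2 fun L R h =>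
    Relation.ReflTransGen.single ⟨1, 1, L, R, .inl h, by simp, by simp⟩
  exact hle (PresentedMonoid.mk_eq_mk_iff.1 h)

theorem PosStep.exists_exchange {X Y : PosWord n} (h : PosStep X Y) :
    ∃ (U V : PosWord n) (a b c d : BandGen n),
      X = U * (FreeMonoid.of a * FreeMonoid.of b) * V ∧
      Y = U * (FreeMonoid.of c * FreeMonoid.of d) * V ∧
      (∀ r : NCPart n, NCPart.cut b (NCPart.cut a r) = NCPart.cut d (NCPart.cut c r)) ∧
      a.Same b.t b.s ∧ c.Same d.t d.s ∧ gen a * gen b = gen c * gen d := by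
  obtain ⟨U, V, L, R, h | h, rfl, rfl⟩ := h
  · obtain ⟨a, b, c, d, rfl, rfl, he⟩ := h.exists_exchange
    exact ⟨U, V, a, b, c, d, rfl, rfl, he.cut_cut, he.same_left, he.same_right, gen_mul_gen h⟩
  · obtain ⟨a, b, c, d, rfl, rfl, he⟩ := h.exists_exchange
    exact ⟨U, V, c, d, a, b, rfl, rfl, fun r => (he.cut_cut r).symm, he.same_right, he.same_left,
      (gen_mul_gen h).symm⟩

open NCPart

/-- `W` is the remainder of the word `w` after division by the maximal simple left divisor. -/
def IsTail (w : PosWord n) (W : BandMonoid n) : Prop :=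
  ∃ a X, w = FreeMonoid.of a * X ∧ (cut a (head n (cls X) (bot n))).simple * W = cls X

theorem IsTail.step {w w' : PosWord n} {W : BandMonoid n}
    (ih : ∀ (b : BandGen n) (V : PosWord n) (z : BandMonoid n), V.length + 2 ≤ w.length →
      gen b * cls V = gen b * z → cls V = z)
    (hs : PosStep w w') (hW : IsTail w W) : IsTail w' W := by
  obtain ⟨e, X, hw, hX⟩ := hW
  obtain ⟨U, V, a, b, c, d, rfl, rfl, hcut, hab, hcd, hrel⟩ := hs.exists_exchange
  have hlen : ∀ U : PosWord n, cls (U * (FreeMonoid.of a * FreeMonoid.of b) * V) =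
      cls (U * (FreeMonoid.of c * FreeMonoid.of d) * V) := by
    intro U
    simp only [map_mul]
    exact congrArg (fun x => cls U * x * cls V) hrel
  cases U using FreeMonoid.casesOn with
  | one =>
    rw [one_mul, mul_assoc] at hw
    obtain ⟨rfl, rfl⟩ := of_mul_inj hw
    refine ⟨c, FreeMonoid.of d * V, by rw [one_mul, mul_assoc], ?_⟩
    have key : ∀ f : BandGen n, ∀ g : BandGen n, f.Same g.t g.s →
        (cut f (head n (cls (FreeMonoid.of g * V)) (bot n))).simple =
          gen g * (cut g (cut f (head n (cls V) (bot n)))).simple := by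
      intro f g hfg
      have h1 : head n (cls (FreeMonoid.of g * V)) (bot n) = act g (head n (cls V) (bot n)) :=
        head_gen_mul g (cls V) (bot n)
      have h2 : (cut f (act g (head n (cls V) (bot n)))).Has g := ⟨has_act _ _, hfg⟩
      rw [h1, simple_eq h2, cut_comm, cut_act, cut_comm]
    rw [key _ _ hab] at hX
    have hV : cls V = (cut b (cut a (head n (cls V) (bot n)))).simple * W := by
      refine ih b V _ (by simp [add_comm]) ?_
      rw [← mul_assoc, hX]
      rfl
    rw [key _ _ hcd, ← hcut, mul_assoc, ← hV]
    rfl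
  | of_mul f U =>
    simp only [mul_assoc] at hw
    obtain ⟨rfl, rfl⟩ := of_mul_inj hw
    refine ⟨f, U * (FreeMonoid.of c * FreeMonoid.of d) * V, by simp only [mul_assoc], ?_⟩
    rw [← hlen U]
    simpa only [mul_assoc] using hX

theorem PosStep.length_eq {X Y : PosWord n} (h : PosStep X Y) : X.length = Y.length := by
  obtain ⟨U, V, a, b, c, d, rfl, rfl, -⟩ := h.exists_exchange
  simp

theorem gen_mul_cancel_word (k : ℕ) : ∀ (a : BandGen n) (X : PosWord n) (y : BandMonoid n),
    X.length = k → gen a * cls X = gen a * y → cls X = y := by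
  induction k using Nat.strong_induction_on with
  | _ k ih =>
    intro a X y hX h
    obtain ⟨Y, rfl⟩ := PresentedMonoid.surjective_mk y
    obtain ⟨W, hW⟩ : (cut a (head n (cls X) (bot n))).simple ∣ cls X :=
      (simple_dvd_simple (v := cut a _) fun _ _ => And.left).trans (simple_head_dvd _)
    have hT : IsTail (FreeMonoid.of a * X) W := ⟨a, X, rfl, hW.symm⟩
    have heq : PosEquiv (FreeMonoid.of a * X) (FreeMonoid.of a * Y) := posEquiv_of_cls_eq h
    have hT' : IsTail (FreeMonoid.of a * Y) W ∧ (FreeMonoid.of a * Y).length = k + 1 := by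
      generalize FreeMonoid.of a * Y = Z at heq
      induction heq with
      | refl => exact ⟨hT, by simp [hX, add_comm]⟩
      | tail _ hs ih' =>
        refine ⟨ih'.1.step (fun b V z hV hz => ih V.length (by omega) b V z rfl hz) hs, ?_⟩
        rw [← hs.length_eq, ih'.2]
    obtain ⟨⟨b, Y', hY', hW'⟩, -⟩ := hT'
    obtain ⟨rfl, rfl⟩ := of_mul_inj hY'
    have hh : act a (head n (cls X) (bot n)) = act a (head n (cls Y) (bot n)) := by
      rw [← head_gen_mul, ← head_gen_mul, h]
    have hc := congrArg (cut a) hh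
    rw [cut_act, cut_act] at hc
    rw [hW, hc, hW']

theorem bandMonoid_left_cancel (x y z : BandMonoid n) (h : x * y = x * z) : y = z := by
  induction x using PresentedMonoid.inductionOn with | _ w
  induction w using FreeMonoid.inductionOn' with
  | one => simpa using h
  | of_mul a w ih =>
    rw [map_mul, mul_assoc, mul_assoc] at h
    obtain ⟨X, hX⟩ := PresentedMonoid.surjective_mk (cls w * y)
    rw [← hX] at h
    exact ih (hX.symm.trans (gen_mul_cancel_word _ a X _ rfl h))

/-! ### Common multiples -/

/-- The fundamental element. -/
noncomputable def delta (n : ℕ) : BandMonoid n := (top n).simple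

theorem simple_dvd_delta (r : NCPart n) : r.simple ∣ delta n := by
  refine simple_dvd_simple fun i j h => ?_
  by_cases hij : i = j
  · exact .inl hij
  · exact .inr ⟨r.supp h hij, r.supp (r.symm h) (Ne.symm hij)⟩

theorem exists_mul_delta_eq (x : BandMonoid n) : ∃ y, x * delta n = delta n * y := by
  induction x using PresentedMonoid.inductionOn with | _ w
  induction w using FreeMonoid.inductionOn' with
  | one => exact ⟨1, by simp⟩
  | of_mul a w ih =>
    obtain ⟨y, hy⟩ := ih
    have ha : (top n).Has a := by
      have := a.one_le
      have := a.lt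
      have := a.le
      exact .inr (by omega)
    have h1 : delta n = gen a * (cut a (top n)).simple := simple_eq ha
    obtain ⟨z, hz⟩ := simple_dvd_delta (cut a (top n))
    refine ⟨z * y, ?_⟩
    calc cls (FreeMonoid.of a * w) * delta n = gen a * (cls w * delta n) := by
          rw [cls, map_mul, mul_assoc]; rfl
      _ = gen a * ((cut a (top n)).simple * z * y) := by rw [hy, hz]
      _ = delta n * (z * y) := by rw [h1]; simp only [mul_assoc]

theorem exists_mul_delta_pow_eq (x : BandMonoid n) (k : ℕ) :
    ∃ y, x * delta n ^ k = delta n ^ k * y := by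
  induction k with
  | zero => exact ⟨x, by simp⟩
  | succ k ih =>
    obtain ⟨y, hy⟩ := ih
    obtain ⟨z, hz⟩ := exists_mul_delta_eq y
    exact ⟨z, by rw [pow_succ, ← mul_assoc, hy, mul_assoc, hz, mul_assoc]⟩

theorem exists_dvd_delta_pow (x : BandMonoid n) : ∃ k, x ∣ delta n ^ k := by
  induction x using PresentedMonoid.inductionOn with | _ w
  induction w using FreeMonoid.inductionOn' with
  | one => exact ⟨0, by simp⟩
  | of_mul a w ih =>
    obtain ⟨k, y, hy⟩ := ih
    have ha : (top n).Has a := by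
      have := a.one_le
      have := a.lt
      have := a.le
      exact .inr (by omega)
    have h1 : delta n = gen a * (cut a (top n)).simple := simple_eq ha
    obtain ⟨z, hz⟩ := exists_mul_delta_pow_eq (cut a (top n)).simple k
    refine ⟨k + 1, y * z, ?_⟩
    rw [pow_succ', h1, mul_assoc, ← h1, hz, hy, map_mul]
    simp only [mul_assoc]; rfl

theorem exists_common_right_multiple (x y : BandMonoid n) : ∃ z w, x * z = y * w := by
  obtain ⟨k, z, hz⟩ := exists_dvd_delta_pow x
  obtain ⟨l, w, hw⟩ := exists_dvd_delta_pow y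
  refine ⟨z * delta n ^ l, w * delta n ^ k, ?_⟩
  rw [← mul_assoc, ← mul_assoc, ← hz, ← hw, ← pow_add, ← pow_add, add_comm]

/-! ### The reversal anti-automorphism -/

/-- The letter `a_{n+1-s, n+1-t}`. -/
def BandGen.flip (a : BandGen n) : BandGen n where
  t := n + 1 - a.s
  s := n + 1 - a.t
  one_le := by have := a.le; omega
  lt := by have := a.lt; have := a.le; omega
  le := by have := a.one_le; omega

theorem BandGen.flip_flip (a : BandGen n) : a.flip.flip = a := by
  have := a.one_le
  have := a.lt
  have := a.le
  ext <;> simp only [BandGen.flip] <;> omega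

/-- The anti-automorphism `a_{ts} ↦ a_{n+1-s, n+1-t}`. -/
def flip (n : ℕ) : BandMonoid n →* (BandMonoid n)ᵐᵒᵖ :=
  PresentedMonoid.lift (fun a => MulOpposite.op (gen a.flip)) (by
    intro L R h
    cases h with
    | comm a b h =>
      simp only [map_mul, FreeMonoid.lift_eval_of, ← MulOpposite.op_mul]
      refine congrArg _ (gen_comm ?_)
      have := a.comm_cases b h
      have := a.le
      have := b.le
      have := a.lt
      have := b.lt
      simp only [BandGen.flip]
      omega
    | left_mid t s r hr hrs hst ht =>
      simp only [map_mul, letter, FreeMonoid.lift_eval_of, ← MulOpposite.op_mul]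
      exact congrArg _ (gen_mul_gen (.left_right (n + 1 - r) (n + 1 - s) (n + 1 - t) (by omega)
        (by omega) (by omega) (by omega)))
    | mid_right t s r hr hrs hst ht =>
      simp only [map_mul, letter, FreeMonoid.lift_eval_of, ← MulOpposite.op_mul]
      exact congrArg _ (gen_mul_gen (.mid_right (n + 1 - r) (n + 1 - s) (n + 1 - t) (by omega)
        (by omega) (by omega) (by omega))).symm
    | left_right t s r hr hrs hst ht =>
      simp only [map_mul, letter, FreeMonoid.lift_eval_of, ← MulOpposite.op_mul]
      exact congrArg _ (gen_mul_gen (.left_mid (n + 1 - r) (n + 1 - s) (n + 1 - t) (by omega)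
        (by omega) (by omega) (by omega))))

theorem flip_flip (x : BandMonoid n) : (flip n (flip n x).unop).unop = x := by
  induction x using PresentedMonoid.inductionOn with | _ w
  induction w using FreeMonoid.inductionOn' with
  | one => simp
  | of_mul a w ih =>
    simp only [map_mul, MulOpposite.unop_mul, ih]
    congr 1
    change gen a.flip.flip = gen a
    rw [a.flip_flip]

theorem flip_mul (x y : BandMonoid n) :
    (flip n (x * y)).unop = (flip n y).unop * (flip n x).unop := by
  rw [map_mul, MulOpposite.unop_mul]

theorem bandMonoid_right_cancel (x y z : BandMonoid n) (h : y * x = z * x) : y = z := by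
  have := congrArg (fun u => (flip n u).unop) h
  simp only [flip_mul] at this
  rw [← flip_flip y, bandMonoid_left_cancel _ _ _ this, flip_flip]

instance : IsCancelMul (BandMonoid n) where
  mul_left_cancel x _ _ h := bandMonoid_left_cancel x _ _ h
  mul_right_cancel x _ _ h := bandMonoid_right_cancel x _ _ h

theorem exists_common_left_multiple (x y : BandMonoid n) : ∃ z w, z * x = w * y := by
  obtain ⟨z, w, h⟩ := exists_common_right_multiple (flip n x).unop (flip n y).unop
  refine ⟨(flip n z).unop, (flip n w).unop, ?_⟩
  have := congrArg (fun u => (flip n u).unop) h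
  simpa only [flip_mul, flip_flip] using this

/-! ### The group of fractions -/

noncomputable instance : OreLocalization.OreSet (⊤ : Submonoid (BandMonoid n)) where
  ore_right_cancel _ _ _ h := ⟨1, by rw [mul_right_cancel h]⟩
  oreNum r s := (exists_common_left_multiple r s.1).choose_spec.choose
  oreDenom r s := ⟨(exists_common_left_multiple r s.1).choose, trivial⟩
  ore_eq r s := (exists_common_left_multiple r s.1).choose_spec.choose_spec

/-- The group of units of the localization of the monoid at all its elements. -/
abbrev FractionGroup (n : ℕ) : Type :=
  (OreLocalization (⊤ : Submonoid (BandMonoid n)) (BandMonoid n))ˣ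

/-- The embedding of the monoid into its group of fractions. -/
noncomputable def toFraction (n : ℕ) : BandMonoid n →* FractionGroup n where
  toFun x := OreLocalization.numeratorUnit ⟨x, trivial⟩
  map_one' := Units.ext (map_one OreLocalization.numeratorHom)
  map_mul' x y := Units.ext (map_mul OreLocalization.numeratorHom x y)

theorem toFraction_injective (n : ℕ) : Function.Injective (toFraction n) := by
  intro x y h
  obtain ⟨u, v, h1, h2⟩ := OreLocalization.oreDiv_eq_iff.1 (congrArg Units.val h)
  obtain rfl : (u : BandMonoid n) = v := by simpa using h2
  exact (mul_left_cancel h1).symm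

/-- The image of the Artin generator `σ_i` in the group of fractions. -/
noncomputable def sigmaFraction (i : ArtinIndex n) : FractionGroup n :=
  toFraction n (gen ⟨i.1 + 1, i.1, i.2.1, Nat.lt_succ_self _, i.2.2⟩)

theorem sigmaFraction_braid {i j : ArtinIndex n} (h : j.1 = i.1 + 1) :
    sigmaFraction i * sigmaFraction j * sigmaFraction i =
      sigmaFraction j * sigmaFraction i * sigmaFraction j := by
  obtain ⟨i, hi⟩ := i
  obtain ⟨j, hj⟩ := j
  simp only at h
  subst h
  have h1 := gen_mul_gen (.left_mid (n := n) (i + 1 + 1) (i + 1) i hi.1 (by omega) (by omega) hj.2)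
  have h2 := gen_mul_gen (.left_right (n := n) (i + 1 + 1) (i + 1) i hi.1 (by omega) (by omega) hj.2)
  simp only [sigmaFraction, ← map_mul]
  refine congrArg _ ?_
  exact (mul_assoc _ _ _).trans ((congrArg (_ * ·) h1).trans
    ((mul_assoc _ _ _).symm.trans (congrArg (· * _) h2.symm)))

/-- The homomorphism from the braid group to the group of fractions. -/
noncomputable def braidToFraction (n : ℕ) : BraidGroup n →* FractionGroup n :=
  PresentedGroup.toGroup (f := sigmaFraction) (by
    intro r hr
    cases hr with
    | comm i j h =>
      rw [map_mul, map_inv, mul_inv_eq_one]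
      simp only [map_mul, FreeGroup.lift_apply_of, sigmaFraction]
      simp only [← map_mul]
      refine congrArg _ (gen_comm ?_)
      rw [lt_abs] at h
      simp only
      omega
    | braid i j h =>
      rw [map_mul, map_inv, mul_inv_eq_one]
      simp only [map_mul, FreeGroup.lift_apply_of]
      rcases (abs_eq zero_le_one).1 h with h | h
      · exact (sigmaFraction_braid (by omega)).symm
      · exact sigmaFraction_braid (by omega))

theorem braidToFraction_sigma {i : ℕ} (h : 1 ≤ i) (h' : i < n) :
    braidToFraction n (sigma n i) =
      toFraction n (gen ⟨i + 1, i, h, Nat.lt_succ_self _, h'⟩) := by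
  rw [sigma, dif_pos ⟨h, h'⟩]
  exact PresentedGroup.toGroup.of _

theorem braidToFraction_bandBraid {t s : ℕ} (hs : 1 ≤ s) (hst : s < t) (ht : t ≤ n) :
    braidToFraction n (bandBraid n t s) = toFraction n (gen ⟨t, s, hs, hst, ht⟩) := by
  induction t, hst using Nat.le_induction with
  | base => rw [bandBraid_self_succ, braidToFraction_sigma hs ht]
  | succ t hst ih =>
    rw [bandBraid_succ n hst, map_mul, map_mul, map_inv, ih (by omega),
      braidToFraction_sigma (by omega) ht, mul_inv_eq_iff_eq_mul, ← map_mul, ← map_mul]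
    exact congrArg _ (gen_mul_gen (.left_mid (t + 1) t s hs hst (Nat.lt_succ_self _) ht))

theorem braidToFraction_comp_naturalMap (n : ℕ) :
    (braidToFraction n).comp (naturalMap n) = toFraction n :=
  PresentedMonoid.ext _ fun a => braidToFraction_bandBraid a.one_le a.lt a.le

theorem naturalMap_injective (n : ℕ) : Function.Injective (naturalMap n) := by
  have h := toFraction_injective n
  rw [← braidToFraction_comp_naturalMap, MonoidHom.coe_comp] at h
  exact h.of_comp

end BandBraid

theorem mainTheorem2 (n : ℕ) :
    Function.Injective (BandBraid.naturalMap n) ∧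
      ∀ X Y : BandBraid.PosWord n,
        BandBraid.wordBraid n X = BandBraid.wordBraid n Y → BandBraid.PosEquiv X Y :=
  ⟨BandBraid.naturalMap_injective n, fun _ _ h =>
    BandBraid.posEquiv_of_cls_eq (BandBraid.naturalMap_injective n h)⟩
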